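/- A straight-line drawing $D$ of a graph places its vertices at distinct points of the plane, no three on a line, and draws each edge as the straight line segment between its endpoints. Two distinct edges cross if their segments have a common point in the relative interiors of both. Let $\overline{\operatorname{cr}}(D)$ be the number of unordered pairs of edges of $D$ that cross, and let $\overline{\operatorname{cr}}_2(D)$ be the minimum, over all colorings of the edges of $D$ with two colors, of the number of unordered pairs of crossing edges of the same color. There exist an integer $n_0>0$ and a constant $c>0$ such that for every $n\ge n_0$ and every straight-line drawing $D$ of the complete graph $K_n$, $\overline{\operatorname{cr}}(D)>0$ and $$\frac{\overline{\operatorname{cr}}_2(D)}{\overline{\operatorname{cr}}(D)}<\frac12-c.$$ -/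

import Mathlib

/-- A straight-line drawing of a graph `G` in the Euclidean plane. It is determined by the positions
of the vertices, which are distinct points with no three of them on a line; every edge is drawn
as the line segment between the positions of its two endpoints. -/
structure StraightLineDrawing {V : Type*} (G : SimpleGraph V) where
  /-- The point of the plane at which a vertex is drawn. -/
  pos : V → EuclideanSpace ℝ (Fin 2)
  /-- Distinct vertices are drawn as distinct points. -/
  pos_injective : Function.Injective pos
  /-- No three of the points lie on a line. -/
  general_position : ∀ u v w : V, u ≠ v → u ≠ w → v ≠ w →
    ¬ Collinear ℝ ({pos u, pos v, pos w} : Set (EuclideanSpace ℝ (Fin 2)))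

namespace StraightLineDrawing

variable {V : Type*} {G : SimpleGraph V}

/-- The relative interior of the segment that joins the positions of the two members of an
unordered pair of vertices. -/
def interiorSegment (D : StraightLineDrawing G) : Sym2 V → Set (EuclideanSpace ℝ (Fin 2)) :=
  Sym2.lift ⟨fun u v => openSegment ℝ (D.pos u) (D.pos v), fun _ _ => openSegment_symm ℝ _ _⟩

/-- Two distinct edges cross in `D` if the segments representing them have a common point in
their relative interiors. -/
def Cross (D : StraightLineDrawing G) (e f : G.edgeSet) : Prop :=
  e ≠ f ∧ (D.interiorSegment e ∩ D.interiorSegment f).Nonempty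

/-- The number of (unordered) pairs of edges that cross in the drawing `D` of a finite graph. -/
noncomputable def crossingNumber (D : StraightLineDrawing G) : ℕ :=
  {p : Sym2 G.edgeSet | ∃ e f, p = s(e, f) ∧ D.Cross e f}.ncard

/-- The number of monochromatic crossings, that is, of (unordered) pairs of edges of the same
color that cross in the drawing `D` of a finite graph, for a 2-edge-coloring `χ`. -/
noncomputable def monochromaticCrossings (D : StraightLineDrawing G)
    (χ : G.EdgeLabeling (Fin 2)) : ℕ :=
  {p : Sym2 G.edgeSet | ∃ e f, p = s(e, f) ∧ D.Cross e f ∧ χ e = χ f}.ncard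

/-- The 2-colored crossing number of `D`: the minimum number of monochromatic crossings over all
2-edge-colorings. (An infimum over a nonempty family of natural numbers is a minimum.) -/
noncomputable def twoColoredCrossingNumber (D : StraightLineDrawing G) : ℕ :=
  ⨅ χ : G.EdgeLabeling (Fin 2), D.monochromaticCrossings χ

end StraightLineDrawing

/-!
# Two colors remove more than half of the crossings of a drawing of `K_n`

A uniformly random 2-coloring of the edges keeps half of the crossings in expectation. A drawing of
`K_n` has at most `n ^ 4 / 2` crossings (`crossingNumber_le`), so it suffices to beat the random
coloring by a fixed multiple of `n ^ 4`.

The gain comes from four vertex sets `A`, `B`, `C`, `E`, each of `k` vertices with `k` linear in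
`n`, such that every edge between `A` and `B` crosses every edge between `C` and `E`
(`exists_crossing_clusters`). Color the `A`-`B` edges red, the `C`-`E` edges blue, and the rest at
random. None of the `k ^ 4` crossings between the two families is monochromatic, where a random
coloring would keep half of them. All crossings inside the two families become monochromatic, but
each family has at most `k ^ 4 / 4` of them, since of the two perfect matchings between `{a, a'}`
and `{b, b'}` at most one has a crossing (`sum_crossGraph_adj_le`). The balance is a gain of at
least `k ^ 4 / 4` (`twoColoredCrossingNumber_add_le`). The random choice is derandomized one edge
at a time: the number of monochromatic crossings is affine in the color `±1` of a single edge
(`exists_sign_form_le`).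

The four sets are found by a same-type argument. Cut the point set by vertical lines into five slabs
of equal size (`exists_slabs`). For three slabs from left to right, a line that bisects the outer
two (`exists_halving_line`) has half of the middle one on one side; keeping that half, and of the
outer slabs the halves on the other side, gives all triangles with one vertex in each of the three
the same orientation (`exists_subsets_orient`). After this has been done for all ten triples, the
orientation of a triangle depends only on the sets its vertices are taken from. Among any five
points in general position four are in convex position (`exists_convex_signs`), so four of the five
sets are in convex position, uniformly in the choice of the points, and the diagonals cross.
-/

/-! ### Rounding a partial coloring -/

open Finset in
/-- A quadratic form without diagonal terms is affine in each variable, so the variables of a vector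
that vanish can be set one by one to `1` or `-1` without increasing the form. -/
theorem exists_sign_form_le {E : Type*} [Fintype E] [DecidableEq E] (w : E → E → ℝ)
    (hw : ∀ e, w e e = 0) (σ : E → ℝ) (hσ : ∀ e, σ e = 0 ∨ σ e = 1 ∨ σ e = -1) :
    ∃ s : E → ℝ, (∀ e, s e = 1 ∨ s e = -1) ∧
      ∑ e, ∑ f, w e f * (s e * s f) ≤ ∑ e, ∑ f, w e f * (σ e * σ f) := by
  induction hk : #{e | σ e = 0} generalizing σ with
  | zero =>
    refine ⟨σ, fun e => ?_, le_rfl⟩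
    have he : e ∉ ({e | σ e = 0} : Finset E) := by simp [card_eq_zero.1 hk]
    exact (hσ e).resolve_left (by simpa using he)
  | succ k ih =>
    obtain ⟨a, ha⟩ : ({e | σ e = 0} : Finset E).Nonempty := card_pos.1 (by omega)
    have ha0 : σ a = 0 := by simpa using ha
    have step : ∀ x : ℝ, (x = 1 ∨ x = -1) →
        (∀ e, Function.update σ a x e = 0 ∨ Function.update σ a x e = 1 ∨
          Function.update σ a x e = -1) ∧ #{e | Function.update σ a x e = 0} = k := by
      intro x hx
      have hx0 : x ≠ 0 := by rcases hx with rfl | rfl <;> norm_num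
      constructor
      · intro e
        by_cases h : e = a
        · subst h; simpa using Or.inr hx
        · simpa [h] using hσ e
      · have : ({e | Function.update σ a x e = 0} : Finset E) =
            ({e | σ e = 0} : Finset E).erase a := by
          ext e
          by_cases h : e = a
          · subst h; simp [hx0]
          · simp [h]
        rw [this, card_erase_of_mem ha, hk]; rfl
    -- The two completions of `σ` at `a` average to `σ`, as the form has no diagonal term.
    have avg : (∑ e, ∑ f, w e f * (Function.update σ a 1 e * Function.update σ a 1 f)) +
        (∑ e, ∑ f, w e f * (Function.update σ a (-1) e * Function.update σ a (-1) f)) =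
        2 * ∑ e, ∑ f, w e f * (σ e * σ f) := by
      have hδ : ∑ e, ∑ f, w e f * ((if e = a then 1 else 0) * (if f = a then 1 else 0)) = 0 := by
        simp [hw]
      have hu : ∀ x e, Function.update σ a x e = σ e + x * (if e = a then 1 else 0) := by
        intro x e
        by_cases h : e = a
        · subst h; simp [ha0]
        · simp [h]
      have hQ : 2 * ∑ e, ∑ f, w e f * (σ e * σ f) = 2 * (∑ e, ∑ f, w e f * (σ e * σ f)) +
          2 * ∑ e, ∑ f, w e f * ((if e = a then 1 else 0) * (if f = a then 1 else 0)) := by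
        rw [hδ, mul_zero, add_zero]
      rw [hQ, ← sum_add_distrib, mul_sum, mul_sum, ← sum_add_distrib]
      refine sum_congr rfl fun e _ => ?_
      rw [← sum_add_distrib, mul_sum, mul_sum, ← sum_add_distrib]
      refine sum_congr rfl fun f _ => ?_
      rw [hu, hu, hu, hu]
      ring
    rcases le_total (∑ e, ∑ f, w e f * (Function.update σ a 1 e * Function.update σ a 1 f))
      (∑ e, ∑ f, w e f * (Function.update σ a (-1) e * Function.update σ a (-1) f)) with h | h
    · obtain ⟨s, hs, hle⟩ := ih _ (step 1 (.inl rfl)).1 (step 1 (.inl rfl)).2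
      exact ⟨s, hs, by linarith⟩
    · obtain ⟨s, hs, hle⟩ := ih _ (step (-1) (.inr rfl)).1 (step (-1) (.inr rfl)).2
      exact ⟨s, hs, by linarith⟩

open Finset Classical in
theorem SimpleGraph.sum_adj_eq_two_mul_ncard {E : Type*} [Fintype E] (H : SimpleGraph E) :
    ∑ e, ∑ f, (if H.Adj e f then (1 : ℝ) else 0) = 2 * H.edgeSet.ncard := by
  have h := H.sum_degrees_eq_twice_card_edges
  rw [Set.ncard_eq_toFinset_card', ← SimpleGraph.edgeFinset]
  have h2 : ((∑ v, H.degree v : ℕ) : ℝ) = ((2 * #H.edgeFinset : ℕ) : ℝ) := by rw [h]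
  push_cast at h2
  rw [← h2]
  refine sum_congr rfl fun e _ => ?_
  rw [← SimpleGraph.card_neighborFinset_eq_degree, SimpleGraph.neighborFinset_eq_filter]
  simp

/-! ### Crossings as a quadratic form -/

namespace StraightLineDrawing

variable {V : Type*} {G : SimpleGraph V}

/-- The crossing graph of a drawing. Its vertices are all unordered pairs of vertices of `G`, so
that no proofs of edge membership are carried along; pairs that are not edges are isolated. -/
def crossGraph (D : StraightLineDrawing G) : SimpleGraph (Sym2 V) where
  Adj e f := e ≠ f ∧ e ∈ G.edgeSet ∧ f ∈ G.edgeSet ∧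
    (D.interiorSegment e ∩ D.interiorSegment f).Nonempty
  symm := ⟨fun _ _ h => ⟨h.1.symm, h.2.2.1, h.2.1, by rw [Set.inter_comm]; exact h.2.2.2⟩⟩
  loopless := ⟨fun _ h => h.1 rfl⟩

/-- The subgraph of the crossing graph that keeps the pairs of equal sign. -/
def monoGraph (D : StraightLineDrawing G) (s : Sym2 V → ℝ) : SimpleGraph (Sym2 V) where
  Adj e f := D.crossGraph.Adj e f ∧ s e = s f
  symm := ⟨fun _ _ h => ⟨h.1.symm, h.2.symm⟩⟩
  loopless := ⟨fun _ h => h.1.1 rfl⟩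

theorem ncard_edgeSet_crossGraph (D : StraightLineDrawing G) :
    D.crossGraph.edgeSet.ncard = D.crossingNumber := by
  rw [crossingNumber, ← Set.ncard_image_of_injective _ (Sym2.map.injective Subtype.val_injective)]
  congr 1
  ext p
  induction p using Sym2.ind with
  | _ e f =>
  simp only [SimpleGraph.mem_edgeSet, Set.mem_image, Set.mem_ofPred_eq]
  constructor
  · rintro ⟨h, he, hf, hi⟩
    exact ⟨s(⟨e, he⟩, ⟨f, hf⟩), ⟨_, _, rfl, fun h' => h (congrArg Subtype.val h'), hi⟩, rfl⟩
  · rintro ⟨_, ⟨e', f', rfl, h⟩, hp⟩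
    rw [← SimpleGraph.mem_edgeSet, ← hp]
    exact ⟨fun h' => h.1 (Subtype.ext h'), e'.2, f'.2, h.2⟩

theorem ncard_edgeSet_monoGraph (D : StraightLineDrawing G) (s : Sym2 V → ℝ)
    (χ : G.EdgeLabeling (Fin 2)) (hχ : ∀ e f, χ e = χ f ↔ s e = s f) :
    (D.monoGraph s).edgeSet.ncard = D.monochromaticCrossings χ := by
  rw [monochromaticCrossings,
    ← Set.ncard_image_of_injective _ (Sym2.map.injective Subtype.val_injective)]
  congr 1
  ext p
  induction p using Sym2.ind with
  | _ e f =>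
  simp only [SimpleGraph.mem_edgeSet, Set.mem_image, Set.mem_ofPred_eq]
  constructor
  · rintro ⟨⟨h, he, hf, hi⟩, hs⟩
    exact ⟨s(⟨e, he⟩, ⟨f, hf⟩),
      ⟨_, _, rfl, ⟨fun h' => h (congrArg Subtype.val h'), hi⟩, (hχ _ _).2 hs⟩, rfl⟩
  · rintro ⟨_, ⟨e', f', rfl, h, hs⟩, hp⟩
    rw [← SimpleGraph.mem_edgeSet, ← hp]
    exact ⟨⟨fun h' => h.1 (Subtype.ext h'), e'.2, f'.2, h.2⟩, (hχ _ _).1 hs⟩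

open Classical Finset in
/-- A partial 2-coloring `σ`, with value `0` on uncolored edges, extends to a full coloring with at
most as many monochromatic crossings as a random extension has on average. -/
theorem twoColoredCrossingNumber_le [Fintype V] (D : StraightLineDrawing G) (σ : Sym2 V → ℝ)
    (hσ : ∀ e, σ e = 0 ∨ σ e = 1 ∨ σ e = -1) :
    (D.twoColoredCrossingNumber : ℝ) ≤ (D.crossingNumber : ℝ) / 2 +
      (∑ e, ∑ f, (if D.crossGraph.Adj e f then (1 : ℝ) else 0) * (σ e * σ f)) / 4 := by
  obtain ⟨s, hs, hle⟩ := exists_sign_form_le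
    (fun e f => if D.crossGraph.Adj e f then (1 : ℝ) else 0) (by simp) σ hσ
  let χ : G.EdgeLabeling (Fin 2) := fun e => if s e = 1 then 0 else 1
  have hχ : ∀ e f, χ e = χ f ↔ s e = s f := by
    intro e f
    rcases hs e with he | he <;> rcases hs f with hf | hf <;>
      simp only [χ, he, hf] <;> norm_num
  have hmin : D.twoColoredCrossingNumber ≤ D.monochromaticCrossings χ :=
    ciInf_le (OrderBot.bddBelow _) χ
  have hmono := (D.monoGraph s).sum_adj_eq_two_mul_ncard
  have hcross := D.crossGraph.sum_adj_eq_two_mul_ncard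
  rw [D.ncard_edgeSet_monoGraph s χ hχ] at hmono
  rw [D.ncard_edgeSet_crossGraph] at hcross
  have hsplit : 2 * ∑ e, ∑ f, (if (D.monoGraph s).Adj e f then (1 : ℝ) else 0) =
      ∑ e, ∑ f, (if D.crossGraph.Adj e f then (1 : ℝ) else 0) +
      ∑ e, ∑ f, (if D.crossGraph.Adj e f then (1 : ℝ) else 0) * (s e * s f) := by
    rw [← sum_add_distrib, mul_sum]
    refine sum_congr rfl fun e _ => ?_
    rw [← sum_add_distrib, mul_sum]
    refine sum_congr rfl fun f _ => ?_
    by_cases h : D.crossGraph.Adj e f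
    · rcases hs e with he | he <;> rcases hs f with hf | hf <;>
        simp only [monoGraph, h, he, hf] <;> norm_num
    · simp [monoGraph, h]
  have hmin' : (D.twoColoredCrossingNumber : ℝ) ≤ D.monochromaticCrossings χ := by
    exact_mod_cast hmin
  linarith

open Finset in
theorem crossingNumber_le [Fintype V] (D : StraightLineDrawing G) :
    (D.crossingNumber : ℝ) ≤ (Fintype.card V : ℝ) ^ 4 / 2 := by
  classical
  have hcross := D.crossGraph.sum_adj_eq_two_mul_ncard
  rw [D.ncard_edgeSet_crossGraph] at hcross
  have h1 : ∑ e, ∑ f, (if D.crossGraph.Adj e f then (1 : ℝ) else 0) ≤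
      ∑ _e : Sym2 V, ∑ _f : Sym2 V, (1 : ℝ) :=
    sum_le_sum fun e _ => sum_le_sum fun f _ => by split_ifs <;> norm_num
  have h2 : (Fintype.card (Sym2 V) : ℝ) ≤ (Fintype.card V : ℝ) ^ 2 := by
    have := Fintype.card_le_of_surjective (fun p : V × V => s(p.1, p.2))
      (Sym2.ind fun a b => ⟨(a, b), rfl⟩)
    rw [Fintype.card_prod] at this
    rw [sq]; exact_mod_cast this
  simp only [sum_const, card_univ, nsmul_eq_mul, mul_one] at h1
  have h3 : (Fintype.card (Sym2 V) : ℝ) * Fintype.card (Sym2 V) ≤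
      (Fintype.card V : ℝ) ^ 2 * (Fintype.card V : ℝ) ^ 2 := by gcongr
  nlinarith

end StraightLineDrawing

/-! ### Orientations and crossings -/

/-- Twice the signed area of the triangle `p q r`: positive if `p`, `q`, `r` is a left turn,
zero if the points are collinear. -/
def orient (p q r : EuclideanSpace ℝ (Fin 2)) : ℝ :=
  (q 0 - p 0) * (r 1 - p 1) - (q 1 - p 1) * (r 0 - p 0)

theorem collinear_of_orient_eq_zero {p q r : EuclideanSpace ℝ (Fin 2)} (hpq : p ≠ q)
    (h : orient p q r = 0) : Collinear ℝ {p, q, r} := by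
  rw [collinear_iff_of_mem (p₀ := p) (by simp)]
  refine ⟨q - p, ?_⟩
  simp only [Set.mem_insert_iff, Set.mem_singleton_iff, forall_eq_or_imp, forall_eq, vadd_eq_add]
  refine ⟨⟨0, by simp⟩, ⟨1, by simp⟩, ?_⟩
  unfold orient at h
  by_cases h0 : q 0 - p 0 = 0
  · have h1 : q 1 - p 1 ≠ 0 := by
      intro h1
      apply hpq
      ext i
      fin_cases i
      · simp; linarith
      · simp; linarith
    refine ⟨(r 1 - p 1) / (q 1 - p 1), ?_⟩
    have h2 : r 0 - p 0 = 0 := by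
      rw [h0, zero_mul, zero_sub, neg_eq_zero] at h
      exact (mul_eq_zero.1 h).resolve_left h1
    ext i
    fin_cases i
    · simp [h0]; linarith
    · simp; field_simp; ring
  · refine ⟨(r 0 - p 0) / (q 0 - p 0), ?_⟩
    ext i
    fin_cases i
    · simp; field_simp; ring
    · simp; field_simp; linarith

/-- The oriented distance from the line `a b` is affine and vanishes at the common point of the
segments, which is a convex combination of `c` and `d` with positive weights. -/
theorem exists_mul_orient_add_eq_zero {a b c d : EuclideanSpace ℝ (Fin 2)}
    (h : (openSegment ℝ a b ∩ openSegment ℝ c d).Nonempty) :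
    ∃ s t : ℝ, 0 < s ∧ 0 < t ∧ s * orient a b c + t * orient a b d = 0 := by
  obtain ⟨z, ⟨u, v, -, -, huv, hz⟩, ⟨s, t, hs, ht, hst, hz'⟩⟩ := h
  refine ⟨s, t, hs, ht, ?_⟩
  have e0 : u * a 0 + v * b 0 = s * c 0 + t * d 0 := by
    simpa using congrArg (fun x : EuclideanSpace ℝ (Fin 2) => x 0) (hz.trans hz'.symm)
  have e1 : u * a 1 + v * b 1 = s * c 1 + t * d 1 := by
    simpa using congrArg (fun x : EuclideanSpace ℝ (Fin 2) => x 1) (hz.trans hz'.symm)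
  obtain rfl : u = 1 - v := by linarith
  obtain rfl : s = 1 - t := by linarith
  unfold orient
  linear_combination (a 1 - b 1) * (-e0) + (b 0 - a 0) * (-e1)

theorem openSegment_inter_nonempty {a b c d : EuclideanSpace ℝ (Fin 2)}
    (h1 : orient a b c * orient a b d < 0) (h2 : orient c d a * orient c d b < 0) :
    (openSegment ℝ a b ∩ openSegment ℝ c d).Nonempty := by
  -- The common point divides `c d` in the ratio of the distances of `c`, `d` from the line `a b`,
  -- and `a b` in the ratio of the distances of `a` and `b` from the line `c d`.
  have key : ∀ x y : ℝ, x * y < 0 → x - y ≠ 0 ∧ 0 < -y / (x - y) ∧ 0 < x / (x - y) := by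
    intro x y hxy
    rcases mul_neg_iff.1 hxy with ⟨hx, hy⟩ | ⟨hx, hy⟩
    · exact ⟨by linarith, div_pos (by linarith) (by linarith), div_pos hx (by linarith)⟩
    · exact ⟨by linarith, div_pos_of_neg_of_neg (by linarith) (by linarith),
        div_pos_of_neg_of_neg hx (by linarith)⟩
  obtain ⟨n1, p1, q1⟩ := key _ _ h1
  obtain ⟨n2, p2, q2⟩ := key _ _ h2
  refine ⟨_, ⟨_, _, p2, q2, by field_simp; ring, rfl⟩, ⟨_, _, p1, q1, by field_simp; ring, ?_⟩⟩
  have hn : orient c d a - orient c d b = -(orient a b c - orient a b d) := by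
    unfold orient; ring
  have hid : ∀ i, -orient a b d * c i + orient a b c * d i =
      orient c d b * a i - orient c d a * b i := by
    rw [Fin.forall_fin_two]
    constructor <;> (unfold orient; ring)
  rw [hn]
  ext i
  simp only [PiLp.add_apply, PiLp.smul_apply, smul_eq_mul]
  field_simp
  linear_combination hid i

theorem orient_add_orient (a b c d : EuclideanSpace ℝ (Fin 2)) :
    orient b c d + orient a b d = orient a c d + orient a b c := by
  unfold orient; ring

namespace StraightLineDrawing

variable {V : Type*} {G : SimpleGraph V}

theorem orient_ne_zero (D : StraightLineDrawing G) {u v w : V} (huv : u ≠ v) (huw : u ≠ w)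
    (hvw : v ≠ w) : orient (D.pos u) (D.pos v) (D.pos w) ≠ 0 := fun h =>
  D.general_position u v w huv huw hvw
    (collinear_of_orient_eq_zero (D.pos_injective.ne huv) h)

theorem not_crossGraph_adj_of_common (D : StraightLineDrawing G) (a b d : V) :
    ¬ D.crossGraph.Adj s(a, b) s(a, d) := by
  rintro ⟨hne, hab, had, hi⟩
  have h1 : a ≠ b := G.ne_of_adj hab
  have h2 : a ≠ d := G.ne_of_adj had
  have h3 : b ≠ d := fun h => hne (by rw [h])
  obtain ⟨s, t, hs, ht, h⟩ := exists_mul_orient_add_eq_zero hi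
  have h0 : orient (D.pos a) (D.pos b) (D.pos a) = 0 := by unfold orient; ring
  rw [h0, mul_zero, zero_add] at h
  exact D.orient_ne_zero h1 h2 h3 ((mul_eq_zero.1 h).resolve_left ht.ne')

theorem orient_mul_orient_neg (D : StraightLineDrawing G) {a b c d : V}
    (h : D.crossGraph.Adj s(a, b) s(c, d)) :
    orient (D.pos a) (D.pos b) (D.pos c) * orient (D.pos a) (D.pos b) (D.pos d) < 0 := by
  have hab : a ≠ b := G.ne_of_adj h.2.1
  have hac : a ≠ c := fun e => D.not_crossGraph_adj_of_common a b d (by rwa [← e] at h)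
  have hbc : b ≠ c := fun e => D.not_crossGraph_adj_of_common b a d
    (by rwa [← e, Sym2.eq_swap] at h)
  obtain ⟨s, t, hs, ht, h⟩ := exists_mul_orient_add_eq_zero h.2.2.2
  have h0 := D.orient_ne_zero hab hac hbc
  rw [mul_neg_iff]
  rcases lt_or_gt_of_ne h0 with h0 | h0
  · right
    refine ⟨h0, ?_⟩
    by_contra! h1
    linarith [mul_pos hs (neg_pos.2 h0), mul_nonneg ht.le (neg_nonneg.2 h1)]
  · left
    refine ⟨h0, ?_⟩
    by_contra! h1
    linarith [mul_pos hs h0, mul_nonneg ht.le h1]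

/-- Of the two ways to join `a`, `c` to `b`, `d` by a perfect matching, at most one has a crossing:
four points span at most one crossing. -/
theorem not_crossGraph_adj_of_adj (D : StraightLineDrawing G) {a b c d : V}
    (h : D.crossGraph.Adj s(a, b) s(c, d)) : ¬ D.crossGraph.Adj s(a, d) s(c, b) := by
  intro h'
  have i1 := D.orient_mul_orient_neg h
  have i2 := D.orient_mul_orient_neg h.symm
  have i3 := D.orient_mul_orient_neg h'
  have i4 := D.orient_mul_orient_neg h'.symm
  have e := orient_add_orient (D.pos a) (D.pos c) (D.pos b) (D.pos d)
  have r1 : orient (D.pos a) (D.pos b) (D.pos c) = -orient (D.pos a) (D.pos c) (D.pos b) := by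
    unfold orient; ring
  have r2 : orient (D.pos c) (D.pos d) (D.pos a) = orient (D.pos a) (D.pos c) (D.pos d) := by
    unfold orient; ring
  have r3 : orient (D.pos c) (D.pos d) (D.pos b) = -orient (D.pos c) (D.pos b) (D.pos d) := by
    unfold orient; ring
  have r4 : orient (D.pos a) (D.pos d) (D.pos c) = -orient (D.pos a) (D.pos c) (D.pos d) := by
    unfold orient; ring
  have r5 : orient (D.pos a) (D.pos d) (D.pos b) = -orient (D.pos a) (D.pos b) (D.pos d) := by
    unfold orient; ring
  have r6 : orient (D.pos c) (D.pos b) (D.pos a) = orient (D.pos a) (D.pos c) (D.pos b) := by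
    unfold orient; ring
  -- The two crossings force the sign pattern `+ - + -` or its negative on the four triangles, which
  -- contradicts the linear relation `e` between their areas.
  rw [r1] at i1
  rw [r2, r3] at i2
  rw [r4, r5] at i3
  rw [r6] at i4
  rw [mul_neg_iff] at i1 i2 i3 i4
  rcases i1 with ⟨_, _⟩ | ⟨_, _⟩ <;> rcases i2 with ⟨_, _⟩ | ⟨_, _⟩ <;>
    rcases i3 with ⟨_, _⟩ | ⟨_, _⟩ <;> rcases i4 with ⟨_, _⟩ | ⟨_, _⟩ <;> linarith

theorem crossGraph_adj_of_orient {V : Type*}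
    (D : StraightLineDrawing (SimpleGraph.completeGraph V)) {a b c d : V}
    (h1 : orient (D.pos a) (D.pos b) (D.pos c) * orient (D.pos a) (D.pos b) (D.pos d) < 0)
    (h2 : orient (D.pos c) (D.pos d) (D.pos a) * orient (D.pos c) (D.pos d) (D.pos b) < 0) :
    D.crossGraph.Adj s(a, b) s(c, d) := by
  have hab : a ≠ b := by rintro rfl; simp [orient] at h1
  have hcd : c ≠ d := by rintro rfl; simp [orient] at h2
  have hca : c ≠ a := by rintro rfl; simp [orient] at h1
  have hcb : c ≠ b := by rintro rfl; simp [orient, mul_comm] at h1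
  refine ⟨?_, by simpa using hab, by simpa using hcd, openSegment_inter_nonempty h1 h2⟩
  intro h
  have : c ∈ s(a, b) := h ▸ Sym2.mem_mk_left c d
  rcases Sym2.mem_iff.1 this with h | h
  · exact hca h
  · exact hcb h

end StraightLineDrawing

/-! ### Halving lines -/

section

open Finset

theorem exists_median {V : Type*} (A : Finset V) (f : V → ℝ) :
    ∃ m, #A ≤ 2 * #{a ∈ A | f a ≤ m} ∧ #A ≤ 2 * #{a ∈ A | m ≤ f a} := by
  classical
  rcases A.eq_empty_or_nonempty with rfl | hA
  · simp
  let K := {v ∈ A.image f | #A ≤ 2 * #{a ∈ A | f a ≤ v}}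
  have hK : K.Nonempty := by
    refine ⟨(A.image f).max' (hA.image f), mem_filter.2 ⟨max'_mem _ _, ?_⟩⟩
    rw [filter_true_of_mem fun a ha => le_max' _ _ (mem_image_of_mem f ha)]
    omega
  refine ⟨K.min' hK, (mem_filter.1 (K.min'_mem hK)).2, ?_⟩
  have hlt : 2 * #{a ∈ A | f a < K.min' hK} ≤ #A := by
    let B := {a ∈ A | f a < K.min' hK}
    rcases B.eq_empty_or_nonempty with hB | hB
    · change 2 * #B ≤ _
      simp [hB]
    · obtain ⟨b, hb, hmax⟩ := exists_max_image B f hB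
      have hb' := mem_filter.1 hb
      have hnot : f b ∉ K := fun h => absurd (K.min'_le _ h) (not_le.2 hb'.2)
      have h1 : ¬ #A ≤ 2 * #{a ∈ A | f a ≤ f b} := fun h =>
        hnot (mem_filter.2 ⟨mem_image_of_mem f hb'.1, h⟩)
      have h2 : #B ≤ #{a ∈ A | f a ≤ f b} :=
        card_le_card fun a ha => mem_filter.2 ⟨(mem_filter.1 ha).1, hmax a ha⟩
      change 2 * #B ≤ _
      omega
  have := card_filter_add_card_filter_not (s := A) (fun a => f a < K.min' hK)
  simp only [not_lt] at this
  omega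

theorem card_le_two_mul_card_filter_le {V : Type*} {A : Finset V} {f : V → ℝ} {k l : ℝ}
    (hkl : k ≤ l) (hA : #A ≤ 2 * #{a ∈ A | f a ≤ k}) : #A ≤ 2 * #{a ∈ A | f a ≤ l} :=
  hA.trans <| Nat.mul_le_mul_left 2 <| card_le_card <|
    monotone_filter_right A fun _ _ h => h.trans hkl

theorem card_le_two_mul_card_filter_ge {V : Type*} {A : Finset V} {f : V → ℝ} {k l : ℝ}
    (hkl : k ≤ l) (hA : #A ≤ 2 * #{a ∈ A | l ≤ f a}) : #A ≤ 2 * #{a ∈ A | k ≤ f a} :=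
  hA.trans <| Nat.mul_le_mul_left 2 <| card_le_card <|
    monotone_filter_right A fun _ _ h => hkl.trans h

theorem exists_median_mem_Icc {V : Type*} (A : Finset V) (f : V → ℝ) {l h : ℝ} (hlh : l ≤ h)
    (hl : #A ≤ 2 * #{a ∈ A | l ≤ f a}) (hh : #A ≤ 2 * #{a ∈ A | f a ≤ h}) :
    ∃ m, l ≤ m ∧ m ≤ h ∧ #A ≤ 2 * #{a ∈ A | f a ≤ m} ∧ #A ≤ 2 * #{a ∈ A | m ≤ f a} := by
  obtain ⟨m, h1, h2⟩ := exists_median A f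
  rcases le_total m l with hm | hm
  · exact ⟨l, le_rfl, hlh, card_le_two_mul_card_filter_le hm h1, hl⟩
  rcases le_total h m with hm' | hm'
  · exact ⟨h, hlh, le_rfl, hh, card_le_two_mul_card_filter_ge hm' h2⟩
  exact ⟨m, hm, hm', h1, h2⟩

/-- The slopes `t` for which some line of slope `t` has half of `C` weakly below it and half of `A`
weakly above it. -/
def halvingSlopes {V : Type*} (x y : V → ℝ) (A C : Finset V) : Set ℝ :=
  {t | ∃ S ∈ A.powerset, ∃ T ∈ C.powerset, #A ≤ 2 * #S ∧ #C ≤ 2 * #T ∧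
    ∀ a ∈ S, ∀ c ∈ T, y c - t * x c ≤ y a - t * x a}

/-- For finite sets, the halving slopes are a finite union of sets cut out by weak inequalities that
are affine in the slope. -/
theorem isClosed_halvingSlopes {V : Type*} (x y : V → ℝ) (A C : Finset V) :
    IsClosed (halvingSlopes x y A C) := by
  have : halvingSlopes x y A C = ⋃ S ∈ A.powerset, ⋃ T ∈ C.powerset,
      {t | #A ≤ 2 * #S ∧ #C ≤ 2 * #T ∧ ∀ a ∈ S, ∀ c ∈ T, y c - t * x c ≤ y a - t * x a} := by
    ext t
    simp only [halvingSlopes, Set.mem_ofPred_eq, Set.mem_iUnion, exists_prop]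
  rw [this]
  refine isClosed_biUnion_finset fun S _ => isClosed_biUnion_finset fun T _ => ?_
  refine isClosed_const.and (isClosed_const.and ?_)
  simp only [Set.ofPred_forall]
  exact isClosed_biInter fun a _ => isClosed_biInter fun c _ =>
    isClosed_le (by fun_prop) (by fun_prop)

theorem mem_halvingSlopes_or {V : Type*} (x y : V → ℝ) (A C : Finset V) (t : ℝ) :
    t ∈ halvingSlopes x y A C ∨ t ∈ halvingSlopes x y C A := by
  obtain ⟨m, h1, h2⟩ := exists_median A fun v => y v - t * x v
  obtain ⟨m', h3, h4⟩ := exists_median C fun v => y v - t * x v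
  rcases le_total m m' with h | h
  · refine .inr ⟨_, mem_powerset.2 (filter_subset _ _), _, mem_powerset.2 (filter_subset _ _),
      h4, h1, fun c hc a ha => ?_⟩
    exact ((mem_filter.1 ha).2.trans h).trans (mem_filter.1 hc).2
  · refine .inl ⟨_, mem_powerset.2 (filter_subset _ _), _, mem_powerset.2 (filter_subset _ _),
      h2, h3, fun a ha c hc => ?_⟩
    exact ((mem_filter.1 hc).2.trans h).trans (mem_filter.1 ha).2

theorem exists_halving_level {V : Type*} {x y : V → ℝ} {A C : Finset V} {t : ℝ}
    (hA : A.Nonempty) (ht : t ∈ halvingSlopes x y A C) :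
    ∃ h, #A ≤ 2 * #{a ∈ A | h ≤ y a - t * x a} ∧ #C ≤ 2 * #{c ∈ C | y c - t * x c ≤ h} := by
  obtain ⟨S, hS, T, hT, h1, h2, h3⟩ := ht
  rw [mem_powerset] at hS hT
  have hS0 : S.Nonempty := card_pos.1 (by have := hA.card_pos; omega)
  obtain ⟨b, hb, hmin⟩ := exists_min_image S (fun v => y v - t * x v) hS0
  refine ⟨y b - t * x b, h1.trans ?_, h2.trans ?_⟩
  · exact Nat.mul_le_mul_left 2 (card_le_card fun a ha => mem_filter.2 ⟨hS ha, hmin a ha⟩)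
  · exact Nat.mul_le_mul_left 2 (card_le_card fun c hc => mem_filter.2 ⟨hT hc, h3 b hb c hc⟩)

theorem exists_mem_halvingSlopes {V : Type*} {x : V → ℝ} (y : V → ℝ) {A C : Finset V}
    (hAC : ∀ a ∈ A, ∀ c ∈ C, x a < x c) :
    (halvingSlopes x y A C).Nonempty ∧ (halvingSlopes x y C A).Nonempty := by
  constructor
  · have : ∀ᶠ t : ℝ in Filter.atTop, ∀ a ∈ A, ∀ c ∈ C, (y c - y a) / (x c - x a) ≤ t := by
      rw [Filter.eventually_all_finset]; intro a _
      rw [Filter.eventually_all_finset]; intro c _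
      exact Filter.eventually_ge_atTop _
    obtain ⟨t, ht⟩ := this.exists
    refine ⟨t, A, mem_powerset_self _, C, mem_powerset_self _, by omega, by omega,
      fun a ha c hc => ?_⟩
    have := (div_le_iff₀ (sub_pos.2 (hAC a ha c hc))).1 (ht a ha c hc)
    linarith
  · have : ∀ᶠ t : ℝ in Filter.atBot, ∀ a ∈ A, ∀ c ∈ C, t ≤ (y c - y a) / (x c - x a) := by
      rw [Filter.eventually_all_finset]; intro a _
      rw [Filter.eventually_all_finset]; intro c _
      exact Filter.eventually_le_atBot _
    obtain ⟨t, ht⟩ := this.exists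
    refine ⟨t, C, mem_powerset_self _, A, mem_powerset_self _, by omega, by omega,
      fun c hc a ha => ?_⟩
    have := (le_div_iff₀ (sub_pos.2 (hAC a ha c hc))).1 (ht a ha c hc)
    linarith

/-- Ham-sandwich theorem for two finite sets in the plane that a vertical line separates: one line
`y = t x + h` bisects both. -/
theorem exists_halving_line {V : Type*} {x : V → ℝ} (y : V → ℝ) {A C : Finset V}
    (hAC : ∀ a ∈ A, ∀ c ∈ C, x a < x c) :
    ∃ t h : ℝ, (#A ≤ 2 * #{a ∈ A | y a - t * x a ≤ h} ∧ #A ≤ 2 * #{a ∈ A | h ≤ y a - t * x a}) ∧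
      #C ≤ 2 * #{c ∈ C | y c - t * x c ≤ h} ∧ #C ≤ 2 * #{c ∈ C | h ≤ y c - t * x c} := by
  rcases A.eq_empty_or_nonempty with rfl | hA
  · obtain ⟨m, hm⟩ := exists_median C fun v => y v - 0 * x v
    exact ⟨0, m, by simp, hm⟩
  rcases C.eq_empty_or_nonempty with rfl | hC
  · obtain ⟨m, hm⟩ := exists_median A fun v => y v - 0 * x v
    exact ⟨0, m, hm, by simp⟩
  -- Two nonempty closed sets cover the connected space of slopes, so they share a slope `t`.
  obtain ⟨⟨t₁, ht₁⟩, ⟨t₂, ht₂⟩⟩ := exists_mem_halvingSlopes y hAC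
  obtain ⟨t, -, htA, htC⟩ := isPreconnected_closed_iff.1 isPreconnected_univ _ _
    (isClosed_halvingSlopes x y A C) (isClosed_halvingSlopes x y C A)
    (fun t _ => mem_halvingSlopes_or x y A C t) ⟨t₁, trivial, ht₁⟩ ⟨t₂, trivial, ht₂⟩
  obtain ⟨h, h1, h2⟩ := exists_halving_level hA htA
  obtain ⟨h', h3, h4⟩ := exists_halving_level hC htC
  -- Between `h` and `h'`, all levels bisect one of the two sets; take a median of the other one.
  rcases le_total h h' with hh | hh
  · obtain ⟨m, hm1, hm2, hm⟩ := exists_median_mem_Icc A (fun v => y v - t * x v) hh h1 h4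
    exact ⟨t, m, hm, card_le_two_mul_card_filter_le hm1 h2,
      card_le_two_mul_card_filter_ge hm2 h3⟩
  · obtain ⟨m, hm1, hm2, hm⟩ := exists_median_mem_Icc C (fun v => y v - t * x v) hh h3 h2
    exact ⟨t, m, ⟨card_le_two_mul_card_filter_le hm1 h4,
      card_le_two_mul_card_filter_ge hm2 h1⟩, hm⟩

/-- Of three sets ordered from left to right, halves can be chosen so that all triangles with one
vertex in each half have the same weak orientation: a line that bisects the outer sets separates the
chosen half of the middle set from the chosen halves of the outer ones. -/
theorem exists_subsets_orient {V : Type*} (P : V → EuclideanSpace ℝ (Fin 2)) {A B C : Finset V}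
    (hAB : ∀ a ∈ A, ∀ b ∈ B, P a 0 < P b 0) (hBC : ∀ b ∈ B, ∀ c ∈ C, P b 0 < P c 0)
    (hAC : ∀ a ∈ A, ∀ c ∈ C, P a 0 < P c 0) :
    ∃ A' ⊆ A, ∃ B' ⊆ B, ∃ C' ⊆ C, #A ≤ 2 * #A' ∧ #B ≤ 2 * #B' ∧ #C ≤ 2 * #C' ∧
      ((∀ a ∈ A', ∀ b ∈ B', ∀ c ∈ C', 0 ≤ orient (P a) (P b) (P c)) ∨
        ∀ a ∈ A', ∀ b ∈ B', ∀ c ∈ C', orient (P a) (P b) (P c) ≤ 0) := by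
  obtain ⟨t, h, ⟨hA1, hA2⟩, hC1, hC2⟩ := exists_halving_line (x := fun v => P v 0)
    (fun v => P v 1) hAC
  -- Orientation is invariant under the affine map that takes the bisecting line to the `x`-axis.
  have shear : ∀ a b c, orient (P a) (P b) (P c) =
      (P b 0 - P a 0) * ((P c 1 - t * P c 0) - h) + (P c 0 - P b 0) * ((P a 1 - t * P a 0) - h)
        - (P b 0 - P a 0 + (P c 0 - P b 0)) * ((P b 1 - t * P b 0) - h) := by
    intro a b c
    unfold orient; ring
  have hB : #B ≤ #{b ∈ B | P b 1 - t * P b 0 ≤ h} + #{b ∈ B | h ≤ P b 1 - t * P b 0} := by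
    classical
    refine (card_le_card fun b hb => ?_).trans (card_union_le _ _)
    rw [mem_union, mem_filter, mem_filter]
    exact (le_total (P b 1 - t * P b 0) h).imp (⟨hb, ·⟩) (⟨hb, ·⟩)
  rcases le_total #{b ∈ B | P b 1 - t * P b 0 ≤ h} #{b ∈ B | h ≤ P b 1 - t * P b 0} with hle | hle
  · refine ⟨_, filter_subset _ _, _, filter_subset _ _, _, filter_subset _ _, hA1,
      (by omega : #B ≤ 2 * #{b ∈ B | h ≤ P b 1 - t * P b 0}), hC1, .inr ?_⟩
    intro a ha b hb c hc
    rw [mem_filter] at ha hb hc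
    have i1 := sub_pos.2 (hAB a ha.1 b hb.1)
    have i2 := sub_pos.2 (hBC b hb.1 c hc.1)
    rw [shear]
    have j1 := mul_nonneg i1.le (sub_nonneg.2 hc.2)
    have j2 := mul_nonneg i2.le (sub_nonneg.2 ha.2)
    have j3 := mul_nonneg (add_pos i1 i2).le (sub_nonneg.2 hb.2)
    linarith
  · refine ⟨_, filter_subset _ _, _, filter_subset _ _, _, filter_subset _ _, hA2,
      (by omega : #B ≤ 2 * #{b ∈ B | P b 1 - t * P b 0 ≤ h}), hC2, .inl ?_⟩
    intro a ha b hb c hc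
    rw [mem_filter] at ha hb hc
    have i1 := sub_pos.2 (hAB a ha.1 b hb.1)
    have i2 := sub_pos.2 (hBC b hb.1 c hc.1)
    rw [shear]
    have j1 := mul_nonneg i1.le (sub_nonneg.2 hc.2)
    have j2 := mul_nonneg i2.le (sub_nonneg.2 ha.2)
    have j3 := mul_nonneg (add_pos i1 i2).le (sub_nonneg.2 hb.2)
    linarith

/-! ### Five sets of the same type in convex position -/

/-- All triangles with one vertex in each of `A`, `B`, `C`, taken in this order, have the same
(weak) orientation. -/
def SameOrient {V : Type*} (P : V → EuclideanSpace ℝ (Fin 2)) (A B C : Finset V) : Prop :=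
  (∀ a ∈ A, ∀ b ∈ B, ∀ c ∈ C, 0 ≤ orient (P a) (P b) (P c)) ∨
    ∀ a ∈ A, ∀ b ∈ B, ∀ c ∈ C, orient (P a) (P b) (P c) ≤ 0

theorem SameOrient.mono {V : Type*} {P : V → EuclideanSpace ℝ (Fin 2)} {A B C A' B' C' : Finset V}
    (h : SameOrient P A B C) (hA : A' ⊆ A) (hB : B' ⊆ B) (hC : C' ⊆ C) :
    SameOrient P A' B' C' :=
  h.imp (fun h a ha b hb c hc => h a (hA ha) b (hB hb) c (hC hc))
    (fun h a ha b hb c hc => h a (hA ha) b (hB hb) c (hC hc))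

/-- Applying `exists_subsets_orient` to the triples in `T` one after the other costs a factor of at
most `2` in the size of each set for each triple. -/
theorem exists_sameOrient_family {ι V : Type*} [LinearOrder ι] (P : V → EuclideanSpace ℝ (Fin 2))
    (X : ι → Finset V) (hX : ∀ i j, i < j → ∀ a ∈ X i, ∀ b ∈ X j, P a 0 < P b 0)
    (T : Finset (ι × ι × ι)) (hT : ∀ p ∈ T, p.1 < p.2.1 ∧ p.2.1 < p.2.2) :
    ∃ Y : ι → Finset V, (∀ i, Y i ⊆ X i) ∧ (∀ i, #(X i) ≤ 2 ^ #T * #(Y i)) ∧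
      ∀ p ∈ T, SameOrient P (Y p.1) (Y p.2.1) (Y p.2.2) := by
  induction T using Finset.induction_on with
  | empty => exact ⟨X, fun _ => Subset.rfl, by simp, by simp⟩
  | insert p T hp ih =>
    obtain ⟨Y, hYX, hcard, hY⟩ := ih fun q hq => hT q (mem_insert_of_mem hq)
    obtain ⟨i, j, k⟩ := p
    obtain ⟨hij, hjk⟩ := hT _ (mem_insert_self _ _)
    simp only at hij hjk
    have hsep : ∀ i j, i < j → ∀ a ∈ Y i, ∀ b ∈ Y j, P a 0 < P b 0 :=
      fun i j h a ha b hb => hX i j h a (hYX i ha) b (hYX j hb)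
    obtain ⟨A, hA, B, hB, C, hC, cA, cB, cC, ho⟩ :=
      exists_subsets_orient P (hsep i j hij) (hsep j k hjk) (hsep i k (hij.trans hjk))
    let Z : ι → Finset V := fun l => if l = i then A else if l = j then B else if l = k then C
      else Y l
    have Zi : Z i = A := by simp [Z]
    have Zj : Z j = B := by simp [Z, hij.ne']
    have Zk : Z k = C := by simp [Z, hjk.ne', (hij.trans hjk).ne']
    have hZ : ∀ l, Z l ⊆ Y l ∧ #(Y l) ≤ 2 * #(Z l) := by
      intro l
      by_cases h1 : l = i
      · subst h1; rw [Zi]; exact ⟨hA, cA⟩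
      by_cases h2 : l = j
      · subst h2; rw [Zj]; exact ⟨hB, cB⟩
      by_cases h3 : l = k
      · subst h3; rw [Zk]; exact ⟨hC, cC⟩
      simp only [Z, h1, h2, h3, if_false]
      exact ⟨Subset.rfl, by omega⟩
    refine ⟨Z, fun l => (hZ l).1.trans (hYX l), fun l => ?_, fun q hq => ?_⟩
    · rw [card_insert_of_notMem hp, pow_succ, mul_assoc]
      exact (hcard l).trans (Nat.mul_le_mul_left _ (hZ l).2)
    · rcases mem_insert.1 hq with rfl | hq
      · simp only [Zi, Zj, Zk]
        exact ho
      · exact (hY q hq).mono (hZ _).1 (hZ _).1 (hZ _).1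

/-- Points in general position contain `l` sets of `m` points each that are separated by vertical
lines. The factor `2` in the hypothesis allows for pairs of points on a common vertical line, of
which only one is used. -/
theorem exists_slabs {V : Type*} [Fintype V] (P : V → EuclideanSpace ℝ (Fin 2))
    (hP : ∀ u v w, u ≠ v → u ≠ w → v ≠ w → orient (P u) (P v) (P w) ≠ 0)
    (l m : ℕ) (hm : 2 * (l * m) ≤ Fintype.card V) :
    ∃ X : Fin l → Finset V, (∀ i, #(X i) = m) ∧
      ∀ i j, i < j → ∀ a ∈ X i, ∀ b ∈ X j, P a 0 < P b 0 := by
  classical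
  let K : Finset ℝ := univ.image fun v => P v 0
  -- A vertical line contains at most two of the points.
  have hK : l * m ≤ #K := by
    have := card_le_mul_card_image (f := fun v => P v 0) (univ : Finset V) 2 fun r _ => by
      by_contra! h
      obtain ⟨a, ha, b, hb, c, hc, hab, hac, hbc⟩ := two_lt_card.1 h
      simp only [mem_filter, mem_univ, true_and] at ha hb hc
      exact hP a b c hab hac hbc (by simp [orient, ha, hb, hc])
    rw [card_univ] at this
    change _ ≤ 2 * #K at this
    omega
  let e := K.orderEmbOfFin rfl
  have hv : ∀ j, ∃ u, P u 0 = e j := fun j => by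
    have := K.orderEmbOfFin_mem rfl j
    simpa only [K, mem_image, mem_univ, true_and] using this
  choose v hv using hv
  have hidx : ∀ (i : Fin l) (j : Fin m), i.1 * m + j.1 < #K := fun i j => by
    have : (i.1 + 1) * m ≤ l * m := Nat.mul_le_mul_right _ i.2
    have := j.2
    rw [Nat.add_mul] at *
    omega
  refine ⟨fun i => univ.image fun j => v ⟨_, hidx i j⟩, fun i => ?_, fun i i' hi a ha b hb => ?_⟩
  · rw [card_image_of_injective, card_univ, Fintype.card_fin]
    intro j j' h
    have h' := congrArg (fun u => P u 0) h
    simp only [hv, e.injective.eq_iff, Fin.mk.injEq] at h'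
    exact Fin.ext (by omega)
  · obtain ⟨j, -, rfl⟩ := mem_image.1 ha
    obtain ⟨j', -, rfl⟩ := mem_image.1 hb
    rw [hv, hv, e.lt_iff_lt, Fin.mk_lt_mk]
    have : (i.1 + 1) * m ≤ i'.1 * m := Nat.mul_le_mul_right _ hi
    have := j.2
    rw [Nat.add_mul] at *
    omega

/-- The sign sequence of the four triangles of four points `a`, `b`, `c`, `d` ordered from left to
right changes at most once: every entry is a positive combination of any earlier one and any later
one, up to a positive factor. The cases `ε = 1` and `ε = -1` treat the two signs together. -/
theorem orient_combinations {a b c d : EuclideanSpace ℝ (Fin 2)} (hab : a 0 < b 0)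
    (hbc : b 0 < c 0) (hcd : c 0 < d 0) {ε : ℝ} :
    (0 < ε * orient a b c → 0 < ε * orient a c d → 0 < ε * orient a b d) ∧
    (0 < ε * orient a b c → 0 < ε * orient b c d → 0 < ε * orient a b d) ∧
    (0 < ε * orient a b c → 0 < ε * orient b c d → 0 < ε * orient a c d) ∧
    (0 < ε * orient a b d → 0 < ε * orient b c d → 0 < ε * orient a c d) := by
  have pos : ∀ {p q r u v w : ℝ}, 0 < u → 0 < v → 0 < w → p * u + r * v = q * w →
      0 < ε * p → 0 < ε * r → 0 < ε * q := by
    intro p q r u v w hu hv hw h hp hr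
    refine pos_of_mul_pos_left ?_ hw.le
    rw [mul_assoc, ← h]
    linarith [mul_pos hp hu, mul_pos hr hv]
  have hac := hab.trans hbc
  have hbd := hbc.trans hcd
  have had := hac.trans hcd
  refine ⟨pos (sub_pos.2 had) (sub_pos.2 hab) (sub_pos.2 hac) ?_,
    pos (sub_pos.2 hbd) (sub_pos.2 hab) (sub_pos.2 hbc) ?_,
    pos (sub_pos.2 hcd) (sub_pos.2 hac) (sub_pos.2 hbc) ?_,
    pos (sub_pos.2 hcd) (sub_pos.2 had) (sub_pos.2 hbd) ?_⟩ <;> (unfold orient; ring)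

/-- The combinatorial form of `orient_combinations`, for the signs of the four triangles of four
points: no sign is enclosed by two opposite ones. -/
def monotoneSigns (s₁ s₂ s₃ s₄ : Bool) : Bool :=
  (s₁ != s₃ || s₂ == s₁) && (s₁ != s₄ || s₂ == s₁) && (s₁ != s₄ || s₃ == s₁) &&
    (s₂ != s₄ || s₃ == s₂)

/-- Among five points in general position four are in convex position, stated for the signs of the
ten triangles. Four points `a`, `b`, `c`, `d` ordered from left to right are in convex position if
and only if the signs of `a b c` and `a b d` agree and those of `a c d` and `b c d` agree. -/
theorem exists_convex_signs : ∀ b₀₁₂ b₀₁₃ b₀₁₄ b₀₂₃ b₀₂₄ b₀₃₄ b₁₂₃ b₁₂₄ b₁₃₄ b₂₃₄ : Bool,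
    monotoneSigns b₀₁₂ b₀₁₃ b₀₂₃ b₁₂₃ → monotoneSigns b₀₁₂ b₀₁₄ b₀₂₄ b₁₂₄ →
    monotoneSigns b₀₁₃ b₀₁₄ b₀₃₄ b₁₃₄ → monotoneSigns b₀₂₃ b₀₂₄ b₀₃₄ b₂₃₄ →
    monotoneSigns b₁₂₃ b₁₂₄ b₁₃₄ b₂₃₄ →
    (b₀₁₂ = b₀₁₃ ∧ b₀₂₃ = b₁₂₃) ∨ (b₀₁₂ = b₀₁₄ ∧ b₀₂₄ = b₁₂₄) ∨ (b₀₁₃ = b₀₁₄ ∧ b₀₃₄ = b₁₃₄) ∨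
    (b₀₂₃ = b₀₂₄ ∧ b₀₃₄ = b₂₃₄) ∨ (b₁₂₃ = b₁₂₄ ∧ b₁₃₄ = b₂₃₄) := by
  intro b₀₁₂ b₀₁₃ b₀₁₄ b₀₂₃ b₀₂₄ b₀₃₄ b₁₂₃ b₁₂₄ b₁₃₄ b₂₃₄
  unfold monotoneSigns
  cases b₀₁₂ <;> cases b₀₁₃ <;> cases b₀₁₄ <;> cases b₀₂₃ <;> grind

theorem monotoneSigns_orient {a b c d : EuclideanSpace ℝ (Fin 2)} (hab : a 0 < b 0)
    (hbc : b 0 < c 0) (hcd : c 0 < d 0) (habc : orient a b c ≠ 0) (habd : orient a b d ≠ 0)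
    (hacd : orient a c d ≠ 0) (hbcd : orient b c d ≠ 0) :
    monotoneSigns (decide (0 < orient a b c)) (decide (0 < orient a b d))
      (decide (0 < orient a c d)) (decide (0 < orient b c d)) := by
  have h1 := orient_combinations hab hbc hcd (ε := 1)
  have h2 := orient_combinations hab hbc hcd (ε := -1)
  simp only [one_mul, neg_mul, neg_pos] at h1 h2
  rcases lt_or_gt_of_ne habc with p | p <;> rcases lt_or_gt_of_ne habd with q | q <;>
    rcases lt_or_gt_of_ne hacd with r | r <;> rcases lt_or_gt_of_ne hbcd with s | s <;>
    simp [monotoneSigns, p, q, r, s, p.not_gt, q.not_gt, r.not_gt, s.not_gt] at h1 h2 ⊢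

/-! ### Crossing clusters and the gain over a random coloring -/

namespace StraightLineDrawing

/-- Every drawing of a complete graph contains four vertex sets of linear size such that every edge
between the first two crosses every edge between the last two. -/
theorem exists_crossing_clusters {V : Type*} [Fintype V]
    (D : StraightLineDrawing (SimpleGraph.completeGraph V)) {k : ℕ} (hk : 0 < k)
    (hkV : 10240 * k ≤ Fintype.card V) :
    ∃ A B C E : Finset V, #A = k ∧ #B = k ∧ #C = k ∧ #E = k ∧
      ∀ a ∈ A, ∀ b ∈ B, ∀ c ∈ C, ∀ e ∈ E, D.crossGraph.Adj s(a, b) s(c, e) := by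
  -- Ten triples cost a factor of `2 ^ 10 = 1024` in size; five slabs and the factor `2` lost to
  -- vertical alignments make up the rest of `10240`.
  obtain ⟨X, hXcard, hX⟩ := exists_slabs D.pos (fun u v w => D.orient_ne_zero) 5 (1024 * k)
    (by omega)
  let T : Finset (Fin 5 × Fin 5 × Fin 5) := {p | p.1 < p.2.1 ∧ p.2.1 < p.2.2}
  have hT : #T = 10 := by decide
  obtain ⟨Y, hYX, hYcard, hY⟩ := exists_sameOrient_family D.pos X hX T (by simp [T])
  have hk' : ∀ i, k ≤ #(Y i) := fun i => by
    have := hYcard i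
    rw [hXcard, hT] at this
    omega
  choose r hr using fun i => card_pos.1 (hk.trans_le (hk' i))
  have hsep : ∀ i j, i < j → ∀ a ∈ Y i, ∀ b ∈ Y j, D.pos a 0 < D.pos b 0 :=
    fun i j h a ha b hb => hX i j h a (hYX i ha) b (hYX j hb)
  have hne : ∀ i j l, i < j → j < l → ∀ a ∈ Y i, ∀ b ∈ Y j, ∀ c ∈ Y l,
      orient (D.pos a) (D.pos b) (D.pos c) ≠ 0 := by
    intro i j l hij hjl a ha b hb c hc
    have ne : ∀ {u v : V}, D.pos u 0 < D.pos v 0 → u ≠ v := fun h e => by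
      rw [e] at h; exact lt_irrefl _ h
    exact D.orient_ne_zero (ne (hsep i j hij a ha b hb)) (ne (hsep i l (hij.trans hjl) a ha c hc))
      (ne (hsep j l hjl b hb c hc))
  have hsign : ∀ i j l, i < j → j < l → ∀ a ∈ Y i, ∀ b ∈ Y j, ∀ c ∈ Y l,
      (0 < orient (D.pos a) (D.pos b) (D.pos c) ↔
        0 < orient (D.pos (r i)) (D.pos (r j)) (D.pos (r l))) := by
    intro i j l hij hjl a ha b hb c hc
    have n1 := hne i j l hij hjl a ha b hb c hc
    have n2 := hne i j l hij hjl _ (hr i) _ (hr j) _ (hr l)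
    rcases hY (i, j, l) (by simp [T, hij, hjl]) with h | h
    · exact iff_of_true ((h a ha b hb c hc).lt_of_ne' n1)
        ((h _ (hr i) _ (hr j) _ (hr l)).lt_of_ne' n2)
    · exact iff_of_false (h a ha b hb c hc).not_gt (h _ (hr i) _ (hr j) _ (hr l)).not_gt
  let β : Fin 5 → Fin 5 → Fin 5 → Bool := fun i j l =>
    decide (0 < orient (D.pos (r i)) (D.pos (r j)) (D.pos (r l)))
  have hmono : ∀ i j l q, i < j → j < l → l < q →
      monotoneSigns (β i j l) (β i j q) (β i l q) (β j l q) := fun i j l q h1 h2 h3 =>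
    monotoneSigns_orient (hsep i j h1 _ (hr i) _ (hr j)) (hsep j l h2 _ (hr j) _ (hr l))
      (hsep l q h3 _ (hr l) _ (hr q)) (hne i j l h1 h2 _ (hr i) _ (hr j) _ (hr l))
      (hne i j q h1 (h2.trans h3) _ (hr i) _ (hr j) _ (hr q))
      (hne i l q (h1.trans h2) h3 _ (hr i) _ (hr l) _ (hr q))
      (hne j l q h2 h3 _ (hr j) _ (hr l) _ (hr q))
  obtain ⟨i, j, l, q, hij, hjl, hlq, h1, h2⟩ : ∃ i j l q, i < j ∧ j < l ∧ l < q ∧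
      β i j l = β i j q ∧ β i l q = β j l q := by
    have := exists_convex_signs (β 0 1 2) (β 0 1 3) (β 0 1 4) (β 0 2 3) (β 0 2 4) (β 0 3 4)
      (β 1 2 3) (β 1 2 4) (β 1 3 4) (β 2 3 4)
      (hmono 0 1 2 3 (by decide) (by decide) (by decide))
      (hmono 0 1 2 4 (by decide) (by decide) (by decide))
      (hmono 0 1 3 4 (by decide) (by decide) (by decide))
      (hmono 0 2 3 4 (by decide) (by decide) (by decide))
      (hmono 1 2 3 4 (by decide) (by decide) (by decide))
    rcases this with h | h | h | h | h
    · exact ⟨0, 1, 2, 3, by decide, by decide, by decide, h⟩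
    · exact ⟨0, 1, 2, 4, by decide, by decide, by decide, h⟩
    · exact ⟨0, 1, 3, 4, by decide, by decide, by decide, h⟩
    · exact ⟨0, 2, 3, 4, by decide, by decide, by decide, h⟩
    · exact ⟨1, 2, 3, 4, by decide, by decide, by decide, h⟩
  simp only [β, decide_eq_decide] at h1 h2
  obtain ⟨Zi, hZi, ci⟩ := exists_subset_card_eq (hk' i)
  obtain ⟨Zj, hZj, cj⟩ := exists_subset_card_eq (hk' j)
  obtain ⟨Zl, hZl, cl⟩ := exists_subset_card_eq (hk' l)
  obtain ⟨Zq, hZq, cq⟩ := exists_subset_card_eq (hk' q)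
  have hmul : ∀ {x y : ℝ}, x ≠ 0 → y ≠ 0 → (x * y < 0 ↔ ¬ (0 < x ↔ 0 < y)) := by
    intro x y hx hy
    rcases lt_or_gt_of_ne hx with hx | hx <;> rcases lt_or_gt_of_ne hy with hy | hy <;>
      simp [mul_neg_iff, hx, hy, hx.not_gt, hy.not_gt]
  have hpos : ∀ {x y : ℝ}, x ≠ 0 → y ≠ 0 → (-x * y < 0 ↔ (0 < x ↔ 0 < y)) := by
    intro x y hx hy
    rcases lt_or_gt_of_ne hx with hx | hx <;> rcases lt_or_gt_of_ne hy with hy | hy <;>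
      simp [mul_pos_iff, hx, hy, hx.not_gt, hy.not_gt]
  -- If all four signs agree, the points form a cup or a cap and the first and third set are
  -- opposite; otherwise the second and third set lie on different sides of the lines that join the
  -- first to the last.
  by_cases h : 0 < orient (D.pos (r i)) (D.pos (r j)) (D.pos (r l)) ↔
      0 < orient (D.pos (r i)) (D.pos (r l)) (D.pos (r q))
  · refine ⟨Zi, Zl, Zj, Zq, ci, cl, cj, cq, fun a ha c hc b hb e he => ?_⟩
    have ha := hZi ha
    have hb := hZj hb
    have hc := hZl hc
    have he := hZq he
    refine D.crossGraph_adj_of_orient ?_ ?_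
    · have e1 : orient (D.pos a) (D.pos c) (D.pos b) = -orient (D.pos a) (D.pos b) (D.pos c) := by
        unfold orient; ring
      rw [e1, hpos (hne i j l hij hjl a ha b hb c hc)
        (hne i l q (hij.trans hjl) hlq a ha c hc e he),
        hsign i j l hij hjl a ha b hb c hc, hsign i l q (hij.trans hjl) hlq a ha c hc e he]
      exact h
    · have e1 : orient (D.pos b) (D.pos e) (D.pos a) = orient (D.pos a) (D.pos b) (D.pos e) := by
        unfold orient; ring
      have e2 : orient (D.pos b) (D.pos e) (D.pos c) = -orient (D.pos b) (D.pos c) (D.pos e) := by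
        unfold orient; ring
      rw [e1, e2, mul_comm, hpos (hne j l q hjl hlq b hb c hc e he)
        (hne i j q hij (hjl.trans hlq) a ha b hb e he),
        hsign i j q hij (hjl.trans hlq) a ha b hb e he, hsign j l q hjl hlq b hb c hc e he]
      tauto
  · refine ⟨Zi, Zq, Zj, Zl, ci, cq, cj, cl, fun a ha e he b hb c hc => ?_⟩
    have ha := hZi ha
    have hb := hZj hb
    have hc := hZl hc
    have he := hZq he
    refine D.crossGraph_adj_of_orient ?_ ?_
    · have e1 : orient (D.pos a) (D.pos e) (D.pos b) = -orient (D.pos a) (D.pos b) (D.pos e) := by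
        unfold orient; ring
      have e2 : orient (D.pos a) (D.pos e) (D.pos c) = -orient (D.pos a) (D.pos c) (D.pos e) := by
        unfold orient; ring
      rw [e1, e2, neg_mul_neg, hmul (hne i j q hij (hjl.trans hlq) a ha b hb e he)
        (hne i l q (hij.trans hjl) hlq a ha c hc e he),
        hsign i j q hij (hjl.trans hlq) a ha b hb e he,
        hsign i l q (hij.trans hjl) hlq a ha c hc e he]
      tauto
    · have e1 : orient (D.pos b) (D.pos c) (D.pos a) = orient (D.pos a) (D.pos b) (D.pos c) := by
        unfold orient; ring
      rw [e1, hmul (hne i j l hij hjl a ha b hb c hc) (hne j l q hjl hlq b hb c hc e he),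
        hsign i j l hij hjl a ha b hb c hc, hsign j l q hjl hlq b hb c hc e he]
      tauto

theorem injOn_mk_of_disjoint {V : Type*} {A B : Finset V} (h : Disjoint A B) :
    Set.InjOn (fun p : V × V => s(p.1, p.2)) (A ×ˢ B : Finset (V × V)) := by
  rintro ⟨a, b⟩ hp ⟨c, d⟩ hq he
  rw [mem_coe, mem_product] at hp hq
  rcases Sym2.eq_iff.1 he with ⟨h1, h2⟩ | ⟨h1, -⟩
  · exact Prod.ext h1 h2
  · simp only at h1 hp hq
    exact absurd (h1 ▸ hp.1) (disjoint_right.1 h hq.2)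

open Classical in
/-- At most half of the ordered pairs of edges between two vertex sets cross, since swapping the
right endpoints of a crossing pair destroys the crossing. -/
theorem sum_crossGraph_adj_le {V : Type*} {G : SimpleGraph V} (D : StraightLineDrawing G)
    {A B : Finset V} (hAB : Disjoint A B) :
    ∑ e ∈ (A ×ˢ B).image (fun p => s(p.1, p.2)), ∑ f ∈ (A ×ˢ B).image (fun p => s(p.1, p.2)),
      (if D.crossGraph.Adj e f then (1 : ℝ) else 0) ≤ (#A * #B : ℝ) ^ 2 / 2 := by
  have hinj := injOn_mk_of_disjoint hAB
  simp only [sum_image hinj]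
  simp only [sum_product]
  let w : V → V → V → V → ℝ := fun a b c d => if D.crossGraph.Adj s(a, b) s(c, d) then 1 else 0
  change ∑ a ∈ A, ∑ b ∈ B, ∑ c ∈ A, ∑ d ∈ B, w a b c d ≤ _
  have h1 : ∑ a ∈ A, ∑ b ∈ B, ∑ c ∈ A, ∑ d ∈ B, w a b c d =
      ∑ a ∈ A, ∑ c ∈ A, ∑ b ∈ B, ∑ d ∈ B, w a b c d :=
    sum_congr rfl fun a _ => sum_comm
  have h2 : ∑ a ∈ A, ∑ c ∈ A, ∑ b ∈ B, ∑ d ∈ B, w a b c d =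
      ∑ a ∈ A, ∑ c ∈ A, ∑ b ∈ B, ∑ d ∈ B, w a d c b :=
    sum_congr rfl fun a _ => sum_congr rfl fun c _ => sum_comm
  have h3 : ∑ a ∈ A, ∑ c ∈ A, ∑ b ∈ B, ∑ d ∈ B, (w a b c d + w a d c b) ≤
      ∑ _a ∈ A, ∑ _c ∈ A, ∑ _b ∈ B, ∑ _d ∈ B, (1 : ℝ) := by
    refine sum_le_sum fun a _ => sum_le_sum fun c _ => sum_le_sum fun b _ =>
      sum_le_sum fun d _ => ?_
    by_cases h : D.crossGraph.Adj s(a, b) s(c, d)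
    · simp [w, h, D.not_crossGraph_adj_of_adj h]
    · simp only [w, h, if_false, zero_add]
      split_ifs <;> norm_num
  simp only [sum_add_distrib, sum_const, nsmul_eq_mul, mul_one] at h3
  rw [h1]
  linarith

theorem sum_sum_sign_indicator {E : Type*} [Fintype E] [DecidableEq E] (w : E → E → ℝ)
    (A B : Finset E) :
    ∑ e, ∑ f, w e f * (((if e ∈ A then 1 else 0) - (if e ∈ B then 1 else 0)) *
        ((if f ∈ A then 1 else 0) - (if f ∈ B then 1 else 0))) =
      ∑ e ∈ A, ∑ f ∈ A, w e f - ∑ e ∈ A, ∑ f ∈ B, w e f - ∑ e ∈ B, ∑ f ∈ A, w e f +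
        ∑ e ∈ B, ∑ f ∈ B, w e f := by
  have h : ∀ S T : Finset E, ∑ e ∈ S, ∑ f ∈ T, w e f =
      ∑ e, ∑ f, w e f * ((if e ∈ S then 1 else 0) * (if f ∈ T then 1 else 0)) := by
    intro S T
    simp
  simp only [h, ← sum_sub_distrib, ← sum_add_distrib]
  refine sum_congr rfl fun e _ => sum_congr rfl fun f _ => ?_
  ring

open Classical in
/-- Coloring the two families of edges from `exists_crossing_clusters` red and blue beats a random
coloring by a quartic amount. -/
theorem twoColoredCrossingNumber_add_le {V : Type*} [Fintype V]
    (D : StraightLineDrawing (SimpleGraph.completeGraph V)) {k : ℕ} (hk : 0 < k)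
    (hkV : 10240 * k ≤ Fintype.card V) :
    (D.twoColoredCrossingNumber : ℝ) + (k : ℝ) ^ 4 / 4 ≤ (D.crossingNumber : ℝ) / 2 := by
  obtain ⟨A, B, C, E, hA, hB, hC, hE, hadj⟩ := D.exists_crossing_clusters hk hkV
  obtain ⟨a₀, ha₀⟩ := card_pos.1 (hk.trans_eq hA.symm)
  obtain ⟨b₀, hb₀⟩ := card_pos.1 (hk.trans_eq hB.symm)
  obtain ⟨c₀, hc₀⟩ := card_pos.1 (hk.trans_eq hC.symm)
  obtain ⟨e₀, he₀⟩ := card_pos.1 (hk.trans_eq hE.symm)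
  have hAB : Disjoint A B := disjoint_left.2 fun v h h' =>
    SimpleGraph.ne_of_adj _
      ((SimpleGraph.mem_edgeSet _).1 (hadj v h v h' c₀ hc₀ e₀ he₀).2.1) rfl
  have hCE : Disjoint C E := disjoint_left.2 fun v h h' =>
    SimpleGraph.ne_of_adj _
      ((SimpleGraph.mem_edgeSet _).1 (hadj a₀ ha₀ b₀ hb₀ v h v h').2.2.1) rfl
  let R := (A ×ˢ B).image (fun p => s(p.1, p.2))
  let S := (C ×ˢ E).image (fun p => s(p.1, p.2))
  have hcross : ∀ e ∈ R, ∀ f ∈ S, D.crossGraph.Adj e f := by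
    intro e he f hf
    obtain ⟨⟨a, b⟩, hp, rfl⟩ := mem_image.1 he
    obtain ⟨⟨c, d⟩, hq, rfl⟩ := mem_image.1 hf
    rw [mem_product] at hp hq
    exact hadj a hp.1 b hp.2 c hq.1 d hq.2
  have hRS : ∀ e ∈ R, e ∉ S := fun e h h' => (hcross e h e h').1 rfl
  have hRcard : (#R : ℝ) = k ^ 2 := by
    rw [card_image_of_injOn (injOn_mk_of_disjoint hAB), card_product, hA, hB]
    push_cast; ring
  have hScard : (#S : ℝ) = k ^ 2 := by
    rw [card_image_of_injOn (injOn_mk_of_disjoint hCE), card_product, hC, hE]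
    push_cast; ring
  have h := D.twoColoredCrossingNumber_le
    (fun e => (if e ∈ R then 1 else 0) - (if e ∈ S then 1 else 0)) (fun e => by
      by_cases h1 : e ∈ R
      · simp [h1, hRS e h1]
      · by_cases h2 : e ∈ S <;> simp [h1, h2])
  rw [sum_sum_sign_indicator] at h
  have hRR := D.sum_crossGraph_adj_le hAB
  have hSS := D.sum_crossGraph_adj_le hCE
  change ∑ e ∈ R, ∑ f ∈ R, _ ≤ _ at hRR
  change ∑ e ∈ S, ∑ f ∈ S, _ ≤ _ at hSS
  rw [hA, hB] at hRR
  rw [hC, hE] at hSS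
  have hRS' : ∑ e ∈ R, ∑ f ∈ S, (if D.crossGraph.Adj e f then (1 : ℝ) else 0) =
      (k : ℝ) ^ 2 * k ^ 2 := by
    rw [sum_congr rfl fun e he => sum_congr rfl fun f hf => if_pos (hcross e he f hf)]
    simp [hRcard, hScard]
  have hSR' : ∑ e ∈ S, ∑ f ∈ R, (if D.crossGraph.Adj e f then (1 : ℝ) else 0) =
      (k : ℝ) ^ 2 * k ^ 2 := by
    rw [sum_congr rfl fun e he => sum_congr rfl fun f hf => if_pos (hcross f hf e he).symm]
    simp [hRcard, hScard]
  rw [hRS', hSR'] at h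
  nlinarith

end StraightLineDrawing

end

theorem theorem3 :
    ∃ n₀ : ℕ, 0 < n₀ ∧ ∃ c : ℝ, 0 < c ∧
      ∀ n : ℕ, n₀ ≤ n → ∀ D : StraightLineDrawing (SimpleGraph.completeGraph (Fin n)),
        0 < D.crossingNumber ∧
          (D.twoColoredCrossingNumber : ℝ) / (D.crossingNumber : ℝ) < 1 / 2 - c := by
  -- With `k = ⌊n / 10240⌋ ≥ n / 20480`, the gain `k ^ 4 / 4` is at least `n ^ 4 / (4 * 20480 ^ 4)`,
  -- while there are at most `n ^ 4 / 2` crossings.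
  refine ⟨10240, by norm_num, 1 / (4 * 20480 ^ 4), by norm_num, fun n hn D => ?_⟩
  have hk : 0 < n / 10240 := by omega
  have h := D.twoColoredCrossingNumber_add_le hk (by rw [Fintype.card_fin]; omega)
  have hle := D.crossingNumber_le
  rw [Fintype.card_fin] at hle
  have hkn : (n : ℝ) ≤ 20480 * (n / 10240 : ℕ) := by
    have : n ≤ 20480 * (n / 10240) := by omega
    exact_mod_cast this
  generalize n / 10240 = k at *
  have hk0 : (0 : ℝ) < k := by exact_mod_cast hk
  have hk4 : (0 : ℝ) < (k : ℝ) ^ 4 := by positivity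
  have hn4 : (n : ℝ) ^ 4 ≤ 20480 ^ 4 * (k : ℝ) ^ 4 := by
    rw [← mul_pow]; gcongr
  have hcr : (0 : ℝ) < D.crossingNumber := by
    have : (0 : ℝ) ≤ D.twoColoredCrossingNumber := Nat.cast_nonneg _
    linarith
  refine ⟨by exact_mod_cast hcr, ?_⟩
  rw [div_lt_iff₀ hcr]
  linarith
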